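/- All graphs are simple. For $n,k\in\mathbb N$ let $\square^n K_k$ (a Hamming graph) be the graph whose vertices are the $n$-tuples with entries in a fixed $k$-element set, two tuples being adjacent if and only if they differ in exactly one coordinate. The dimension $\dim(G)$ of a graph $G$ is the smallest $n$ such that, for some $k\in\mathbb N$, $G$ is isomorphic to an induced subgraph of $\square^n K_k$; it is infinite if there is no such $n$. A graph $G$ is called $H$-induced-saturated if $G$ has no induced subgraph isomorphic to $H$, but deleting any edge from $G$, and adding any edge of the complement of $G$ to $G$, results in a graph that has an induced subgraph isomorphic to $H$. For $n\ge 3$ let $\mathcal H(n)$ be the class of connected graphs $H$ that have a cut vertex $r$ of degree $n+1$ such that $H-r$ has exactly $n+1$ connected components, each of dimension at most $n-1$. Theorem A. For every $n\ge 3$ and every $H\in\mathcal H(n)$ there is an integer $k\ge 2$ such that $\square^n K_k$ is $H$-induced-saturated. -/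

import Mathlib

namespace InducedSaturation

open SimpleGraph

/-- The Hamming graph `□ⁿ K_k`: the vertices are the `n`-tuples with entries in a `k`-element set,
two of them being adjacent iff they differ in exactly one coordinate. -/
def hammingGraph (n k : ℕ) : SimpleGraph (Fin n → Fin k) where
  Adj x y := ∃! i, x i ≠ y i
  symm := ⟨fun _ _ ⟨i, hi, hu⟩ => ⟨i, hi.symm, fun j hj => hu j hj.symm⟩⟩
  loopless := ⟨fun _ ⟨_, hi, _⟩ => hi rfl⟩

/-- The dimension of a graph: the least `n` such that `G` is isomorphic to an induced subgraph of
`□ⁿ K_k` for some `k`, and `⊤` if there is no such `n`. -/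
noncomputable def dim {V : Type*} (G : SimpleGraph V) : ℕ∞ :=
  sInf {d : ℕ∞ | ∃ n : ℕ, d = n ∧ ∃ k : ℕ, G.IsIndContained (hammingGraph n k)}

/-- The graph `G - r`, obtained by removing the vertex `r`. -/
abbrev removeVertex {V : Type*} (G : SimpleGraph V) (r : V) : SimpleGraph ({r}ᶜ : Set V) :=
  G.induce ({r}ᶜ : Set V)

/-- `r` is a cut vertex of `G`: its removal separates two other vertices that are joined by
a path in `G`. -/
def IsCutVertex {V : Type*} (G : SimpleGraph V) (r : V) : Prop :=
  ∃ u v : ({r}ᶜ : Set V), G.Reachable u v ∧ ¬ (removeVertex G r).Reachable u v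

/-- The class `𝓗(n)`: connected graphs with a cut vertex `r` of degree `n + 1` such that `H - r` has
`n + 1` connected components, each of dimension at most `n - 1`. -/
def ClassH {V : Type*} (n : ℕ) (H : SimpleGraph V) : Prop :=
  H.Connected ∧ ∃ r : V,
    IsCutVertex H r ∧
    (H.neighborSet r).ncard = n + 1 ∧
    Nat.card (removeVertex H r).ConnectedComponent = n + 1 ∧
    ∀ C : (removeVertex H r).ConnectedComponent, dim C.toSimpleGraph ≤ ((n - 1 : ℕ) : ℕ∞)

/-- `G` is `H`-induced-saturated: `G` has no induced copy of `H`, but deleting any edge of `G`, or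
adding to `G` any edge of its complement, creates one. -/
def InducedSaturated {V W : Type*} (G : SimpleGraph W) (H : SimpleGraph V) : Prop :=
  ¬ H.IsIndContained G ∧
  (∀ u v : W, G.Adj u v → H.IsIndContained (G.deleteEdges {s(u, v)})) ∧
  (∀ u v : W, Gᶜ.Adj u v → H.IsIndContained (G ⊔ edge u v))

end InducedSaturation

/-!
Let `H ∈ 𝓗(n)` with cut vertex `r`. Since `H` is connected and `r` has as many neighbours as
`H - r` has components, each component (an *arm*) contains exactly one neighbour of `r`, its
attaching vertex. So `r` is the centre of an induced star with `n + 1` leaves. A Hamming graph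
`□ⁿ K_k` has no such star: two of any `n + 1` neighbours of a vertex differ from it in the same
coordinate, and are then equal or adjacent (`ArmDecomposition.not_isIndContained`).

Once `k` is large, deleting or adding an edge produces a copy of `H`, and both cases are
instances of one construction (`ArmDecomposition.isIndContained_of_adj_iff`). Let `w` and `v`
differ in the coordinate `p`, and let `z` be obtained from `w` by changing the `p`-th entry to a
third symbol. Suppose that a graph `G'` agrees with `□ⁿ K_k` except possibly on the pairs `wv` and
`zv`, that `wv` is an edge of `G'` and that `zv` is not. Then `w` has `n + 1` independent neighbours
in `G'`: the vertex `v`, the vertex `z`, and one vertex in each direction other than `p`. Send `r`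
to `w` and the attaching vertices to these neighbours. An arm has dimension at most `n - 1`, so it
fits into a hyperplane through its neighbour of `w` that misses `w`; moreover, at every
coordinate, each arm can use symbols of its own apart from the entry of its attaching vertex. Any
two vertices in distinct arms then differ in two coordinates, except for vertices of the arms at
`v` and `z`, where the only pair that could be adjacent is `vz` itself.

* If the edge `uv` is deleted, take a third vertex `w` on the line through `u` and `v`, so `z = u`.
* If the edge `uv` is added, take `w = u`; then `z` and `v` still differ in two coordinates.
-/

namespace InducedSaturation

open SimpleGraph

/-! ### Decomposing a graph into a root and its arms -/

/-- A vertex `root` of `H` together with a partition of the remaining vertices into `n + 1` arms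
with no edges between them, each containing exactly one neighbour of `root`, and such that each
arm is an induced subgraph of a hyperplane of `□ⁿ K_m` orthogonal to any prescribed direction.
The value of `arm` at `root` carries no meaning. -/
structure ArmDecomposition {V : Type*} (H : SimpleGraph V) (n m : ℕ) where
  root : V
  arm : V → Option (Fin n)
  attach : Option (Fin n) → V
  attach_ne : ∀ i, attach i ≠ root
  arm_attach : ∀ i, arm (attach i) = i
  adj_root : ∀ x, x ≠ root → (H.Adj root x ↔ x = attach (arm x))
  arm_eq : ∀ x y, x ≠ root → y ≠ root → H.Adj x y → arm x = arm y
  exists_coords : ∀ d : Option (Fin n) → Fin n, ∃ e : V → Fin n → Fin m,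
    ∀ x y, x ≠ root → y ≠ root → arm x = arm y →
      (H.Adj x y ↔ (hammingGraph n m).Adj (e x) (e y)) ∧ (e x = e y → x = y) ∧
        e x (d (arm x)) = e y (d (arm x))

/-- A graph of dimension at most `n - 1` embeds into any coordinate hyperplane of `□ⁿ K_m` for all
large `m`. -/
lemma exists_embedding_hyperplane {V : Type*} {G : SimpleGraph V} {n : ℕ} (hn : 0 < n)
    (h : dim G ≤ ((n - 1 : ℕ) : ℕ∞)) :
    ∃ k : ℕ, ∀ m, k < m → ∀ d : Fin n, ∃ e : G ↪g hammingGraph n m, ∀ x y, e x d = e y d := by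
  have hne : {d : ℕ∞ | ∃ n : ℕ, d = n ∧ ∃ k : ℕ, G.IsIndContained (hammingGraph n k)}.Nonempty := by
    by_contra hcon
    rw [Set.not_nonempty_iff_eq_empty] at hcon
    rw [dim, hcon, sInf_empty, top_le_iff] at h
    exact ENat.natCast_ne_top _ h
  obtain ⟨N, hN, k, ⟨f⟩⟩ := csInf_mem hne
  have hNn : N ≤ n - 1 := by
    have : (N : ℕ∞) ≤ ((n - 1 : ℕ) : ℕ∞) := hN ▸ h
    exact_mod_cast this
  refine ⟨k, fun m hm d => ?_⟩
  obtain ⟨q, rfl⟩ : ∃ q, n = q + 1 := ⟨n - 1, by omega⟩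
  let g : Fin N → Fin (q + 1) := fun i => d.succAbove (Fin.castLE hNn i)
  have hg : Function.Injective g := fun i j hij =>
    Fin.castLE_injective hNn (Fin.succAbove_right_injective hij)
  let pad : (Fin N → Fin k) → Fin (q + 1) → Fin m := fun x =>
    Function.extend g (fun i => Fin.castLE hm.le (x i)) (fun _ => ⟨0, by omega⟩)
  have hpad : ∀ x i, pad x (g i) = Fin.castLE hm.le (x i) := fun x i =>
    hg.extend_apply _ _ i
  have hpad' : ∀ x y j, (¬ ∃ i, g i = j) → pad x j = pad y j := fun x y j hj => by
    simp only [pad, Function.extend_apply' _ _ _ hj]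
  have hiff : ∀ x y i, pad x (g i) ≠ pad y (g i) ↔ x i ≠ y i := fun x y i => by
    rw [hpad, hpad]; exact (Fin.castLE_injective hm.le).ne_iff
  have hinj : Function.Injective pad := fun x y hxy => funext fun i => by
    by_contra hi
    exact (hiff x y i).2 hi (congrFun hxy _)
  refine ⟨⟨⟨fun x => pad (f x), hinj.comp f.injective⟩, ?_⟩, fun x y => ?_⟩
  · intro x y
    rw [← f.map_rel_iff]
    constructor
    · rintro ⟨j, hj, hu⟩
      obtain ⟨i, rfl⟩ : ∃ i, g i = j := by
        by_contra hcon
        exact hj (hpad' _ _ j hcon)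
      exact ⟨i, (hiff _ _ i).1 hj, fun i' hi' => hg (hu _ ((hiff _ _ i').2 hi'))⟩
    · rintro ⟨i, hi, hu⟩
      refine ⟨g i, (hiff _ _ i).2 hi, fun j hj => ?_⟩
      obtain ⟨i', rfl⟩ : ∃ i', g i' = j := by
        by_contra hcon
        exact hj (hpad' _ _ j hcon)
      rw [hu i' ((hiff _ _ i').1 hj)]
  · exact hpad' _ _ d fun ⟨i, hi⟩ => Fin.succAbove_ne _ _ hi

/-- In a connected graph, every component of `G - r` contains a neighbour of `r`. -/
lemma exists_adj_of_connected {V : Type*} {G : SimpleGraph V} (hG : G.Connected) (r : V)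
    (C : (removeVertex G r).ConnectedComponent) :
    ∃ x : ({r}ᶜ : Set V), (removeVertex G r).connectedComponentMk x = C ∧ G.Adj r x := by
  have key : ∀ a b, G.Walk a b → b = r → ∀ ha : a ≠ r, ∃ x : ({r}ᶜ : Set V),
      (removeVertex G r).connectedComponentMk x =
        (removeVertex G r).connectedComponentMk ⟨a, ha⟩ ∧ G.Adj r x := by
    intro a b p
    induction p with
    | nil => exact fun h ha => absurd h ha
    | @cons a c b hac p ih =>
      intro hb ha
      by_cases hc : c = r
      · subst hc
        exact ⟨⟨a, ha⟩, rfl, hac.symm⟩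
      · obtain ⟨x, hx, hrx⟩ := ih hb hc
        refine ⟨x, hx.trans (ConnectedComponent.sound (Adj.reachable ?_)), hrx⟩
        exact hac.symm
  induction C using ConnectedComponent.ind with
  | h a =>
    obtain ⟨p⟩ := hG.preconnected a.1 r
    exact key _ _ p rfl a.2

/-- In `H ∈ 𝓗(n)`, the components of `H - r` serve as arms: each of them contains a neighbour of `r`,
and only one, because there are as many components as neighbours. -/
theorem ClassH.exists_armDecomposition {V : Type*} {n : ℕ} (hn : 0 < n) {H : SimpleGraph V}
    (hH : ClassH n H) : ∃ m, Nonempty (ArmDecomposition H n m) := by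
  classical
  obtain ⟨hconn, r, -, hdeg, hcard, hdim⟩ := hH
  have : Finite (removeVertex H r).ConnectedComponent :=
    Nat.finite_of_card_ne_zero (by omega)
  let _ := Fintype.ofFinite (removeVertex H r).ConnectedComponent
  have : Finite (H.neighborSet r) := Set.finite_of_ncard_ne_zero (by omega)
  choose c hcC hcr using exists_adj_of_connected hconn r
  -- Choosing a neighbour of `r` in each component is injective, hence bijective by counting.
  have hbij : Function.Bijective
      (fun C => (⟨c C, hcr C⟩ : H.neighborSet r)) := by
    refine (Nat.bijective_iff_injective_and_card _).2 ⟨fun C D hCD => ?_, ?_⟩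
    · have : c C = c D := Subtype.ext (congrArg (fun x : H.neighborSet r => x.1) hCD)
      rw [← hcC C, ← hcC D, this]
    · rw [hcard, Nat.card_coe_set_eq, hdeg]
  obtain ⟨φ⟩ : Nonempty ((removeVertex H r).ConnectedComponent ≃ Option (Fin n)) := by
    refine Finite.card_eq.1 ?_
    rw [hcard]; simp
  choose k hk using fun C => exists_embedding_hyperplane hn (hdim C)
  let comp : ∀ x, x ≠ r → (removeVertex H r).ConnectedComponent := fun x hx =>
    (removeVertex H r).connectedComponentMk ⟨x, hx⟩
  let arm : V → Option (Fin n) := fun x => if hx : x = r then none else φ (comp x hx)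
  have harm : ∀ x (hx : x ≠ r), arm x = φ (comp x hx) := fun x hx => dif_neg hx
  refine ⟨(∑ C, k C) + 1, ⟨⟨r, arm, fun i => c (φ.symm i), fun i => (c _).2, fun i => ?_,
    fun x hx => ?_, fun x y hx hy hxy => ?_, fun d => ?_⟩⟩⟩
  · rw [harm _ (c _).2]
    change φ ((removeVertex H r).connectedComponentMk (c (φ.symm i))) = i
    rw [hcC, φ.apply_symm_apply]
  · rw [harm x hx, φ.symm_apply_apply]
    constructor
    · intro hrx
      obtain ⟨C, hC⟩ := hbij.2 ⟨x, hrx⟩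
      have hx' : (c C : V) = x := congrArg Subtype.val hC
      have : comp x hx = C := by
        rw [← hcC C]
        exact congrArg _ (Subtype.ext hx'.symm)
      rw [this, hx']
    · intro h
      rw [h]
      exact hcr _
  · rw [harm x hx, harm y hy]
    exact congrArg φ (ConnectedComponent.sound (Adj.reachable hxy))
  · choose e he using fun C => hk C ((∑ C, k C) + 1)
      (Nat.lt_succ_of_le (Finset.single_le_sum (fun _ _ => Nat.zero_le _) (Finset.mem_univ C)))
      (d (φ C))
    refine ⟨fun x => if hx : x = r then fun _ => 0 else e (comp x hx) ⟨⟨x, hx⟩, rfl⟩,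
      fun x y hx hy hxy => ?_⟩
    rw [harm x hx, harm y hy] at hxy
    have hC : comp y hy = comp x hx := (φ.injective hxy).symm
    have hey : ∀ C (h : comp y hy = C), e (comp y hy) ⟨⟨y, hy⟩, rfl⟩ = e C ⟨⟨y, hy⟩, h⟩ := by
      rintro C rfl; rfl
    simp only [dif_neg hx, dif_neg hy, harm x hx, hey _ hC]
    refine ⟨?_, fun h => ?_, he _ _ _⟩
    · exact ((e (comp x hx)).map_rel_iff (a := ⟨⟨x, hx⟩, rfl⟩) (b := ⟨⟨y, hy⟩, hC⟩)).symm
    · exact congrArg (fun z => ((z.1 : ({r}ᶜ : Set V)) : V)) ((e (comp x hx)).injective h)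

namespace ArmDecomposition

variable {V : Type*} {H : SimpleGraph V} {n m : ℕ}

/-! ### Stars in Hamming graphs -/

/-- A Hamming graph `□ⁿ K_k` has no induced star with `n + 1` leaves. -/
theorem not_isIndContained (D : ArmDecomposition H n m) (k : ℕ) :
    ¬ H.IsIndContained (hammingGraph n k) := by
  rintro ⟨f⟩
  have hadj : ∀ i, (hammingGraph n k).Adj (f D.root) (f (D.attach i)) := fun i =>
    f.map_rel_iff.2 ((D.adj_root _ (D.attach_ne i)).2 (by rw [D.arm_attach]))
  choose q _ hu using hadj
  obtain ⟨i, j, hij, hq⟩ : ∃ i j, i ≠ j ∧ q i = q j := by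
    obtain ⟨i, j, hij, hq⟩ := Fintype.exists_ne_map_eq_of_card_lt q (by simp)
    exact ⟨i, j, hij, hq⟩
  have hagree : ∀ l, l ≠ q i → f (D.attach i) l = f (D.attach j) l := fun l hl => by
    have h1 : f D.root l = f (D.attach i) l := by
      by_contra h; exact hl (hu i l h)
    have h2 : f D.root l = f (D.attach j) l := by
      by_contra h; exact hl ((hu j l h).trans hq.symm)
    rw [← h1, h2]
  have hne : f (D.attach i) ≠ f (D.attach j) := fun h => hij <| by
    rw [← D.arm_attach i, ← D.arm_attach j, f.injective h]
  have hat : f (D.attach i) (q i) ≠ f (D.attach j) (q i) := fun h => hne <| funext fun l => by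
    by_cases hl : l = q i
    · rw [hl, h]
    · exact hagree l hl
  have : H.Adj (D.attach i) (D.attach j) := f.map_rel_iff.1
    ⟨q i, hat, fun l hl => by by_contra h; exact hl (hagree l h)⟩
  have := D.arm_eq _ _ (D.attach_ne i) (D.attach_ne j) this
  rw [D.arm_attach, D.arm_attach] at this
  exact hij this

/-! ### Embedding the arms around a vertex -/

/-- In a set of `k` symbols there is room for `m` private symbols for each of the `n + 1` arms that
avoid three given ones. -/
lemma exists_fresh_symbols {k : ℕ} (hk : (n + 1) * m + 3 ≤ k) (a b c : Fin k) :
    ∃ σ : Option (Fin n) × Fin m → Fin k, Function.Injective σ ∧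
      ∀ s, σ s ≠ a ∧ σ s ≠ b ∧ σ s ≠ c := by
  classical
  have hcard : Fintype.card (Option (Fin n) × Fin m) ≤
      Fintype.card {x : Fin k // x ∉ ({a, b, c} : Finset (Fin k))} := by
    have h3 : ({a, b, c} : Finset (Fin k)).card ≤ 3 := Finset.card_le_three
    rw [Fintype.card_subtype_compl, Fintype.card_coe, Fintype.card_prod, Fintype.card_option,
      Fintype.card_fin, Fintype.card_fin, Fintype.card_fin]
    omega
  obtain ⟨σ⟩ := Function.Embedding.nonempty_of_card_le hcard
  refine ⟨fun s => (σ s).1, Subtype.val_injective.comp σ.injective, fun s => ?_⟩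
  have := (σ s).2
  simpa only [Finset.mem_insert, Finset.mem_singleton, not_or] using this

/-- If `G'` agrees with the Hamming graph except possibly on the pairs `{w, v}` and `{z, v}`, where
`z` differs from `w` in the coordinate `p` only, and if `G'` has the edge `wv` but not the edge
`zv`, then `G'` contains an induced copy of `H` with root `w`. The vector `t` gives the entries in
which the neighbours of `w` other than `v` differ from it. -/
theorem isIndContained_of_adj_iff (D : ArmDecomposition H n m) {k : ℕ}
    (hk : (n + 1) * m + 3 ≤ k) {G' : SimpleGraph (Fin n → Fin k)} (p : Fin n)
    (w v t : Fin n → Fin k) (hvw : v p ≠ w p) (htw : ∀ j, t j ≠ w j) (htv : ∀ j, t j ≠ v j)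
    (hwv : G'.Adj w v) (hzv : ¬ G'.Adj (Function.update w p (t p)) v)
    (hG' : ∀ x y, s(x, y) ≠ s(w, v) → s(x, y) ≠ s(Function.update w p (t p), v) →
      (G'.Adj x y ↔ (hammingGraph n k).Adj x y)) :
    H.IsIndContained G' := by
  classical
  set z := Function.update w p (t p)
  choose σ hσ hσne using fun j => exists_fresh_symbols (n := n) (m := m) hk (w j) (v j) (t j)
  let dir : Option (Fin n) → Fin n := fun i => i.getD p
  obtain ⟨e, he⟩ := D.exists_coords dir
  -- `base i` is the neighbour of `w` to which the attaching vertex of the arm `i` is sent, and all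
  -- images of this arm agree with it in the coordinate `dir i`.
  let base : Option (Fin n) → Fin n → Fin k := fun i =>
    i.elim v (fun j => Function.update w j (t j))
  have base_cases : ∀ i j, base i j = w j ∨ base i j = v j ∨ base i j = t j := by
    rintro (_ | i) j
    · exact Or.inr (Or.inl rfl)
    · by_cases h : j = i
      · subst h; exact Or.inr (Or.inr (Function.update_self _ _ _))
      · exact Or.inl (Function.update_of_ne h _ _)
  have base_self : ∀ j, base (some j) j = t j := fun j => Function.update_self _ _ _
  have base_ne : ∀ i j, j ≠ i → base (some i) j = w j := fun i j h => Function.update_of_ne h _ _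
  have σ_ne_base : ∀ j s i, σ j s ≠ base i j := fun j s i h => by
    obtain ⟨h1, h2, h3⟩ := hσne j s
    rcases base_cases i j with h' | h' | h' <;> rw [h'] at h <;> contradiction
  -- The symbol of the attaching vertex becomes the entry of `base`; all others become private.
  let F : V → Fin n → Fin k := fun x j =>
    if e x j = e (D.attach (D.arm x)) j then base (D.arm x) j else σ j (D.arm x, e x j)
  have F_cases : ∀ x j, (e x j = e (D.attach (D.arm x)) j ∧ F x j = base (D.arm x) j) ∨
      (e x j ≠ e (D.attach (D.arm x)) j ∧ F x j = σ j (D.arm x, e x j)) := fun x j => by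
    by_cases h : e x j = e (D.attach (D.arm x)) j
    · exact Or.inl ⟨h, if_pos h⟩
    · exact Or.inr ⟨h, if_neg h⟩
  have F_eq_iff : ∀ x y, D.arm x = D.arm y → ∀ j, (F x j = F y j ↔ e x j = e y j) := by
    intro x y hxy j
    rcases F_cases x j with ⟨h1, h2⟩ | ⟨h1, h2⟩ <;> rcases F_cases y j with ⟨h3, h4⟩ | ⟨h3, h4⟩ <;>
      rw [h2, h4]
    · rw [h1, h3, hxy]; simp
    · rw [h1, hxy]; exact iff_of_false (σ_ne_base _ _ _).symm (Ne.symm h3)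
    · rw [h3, ← hxy]; exact iff_of_false (σ_ne_base _ _ _) h1
    · rw [(hσ j).eq_iff, hxy]; simp
  have F_dir : ∀ x, x ≠ D.root → F x (dir (D.arm x)) = base (D.arm x) (dir (D.arm x)) :=
    fun x hx => if_pos (he x _ hx (D.attach_ne _) (D.arm_attach _).symm).2.2
  have F_none : ∀ x, x ≠ D.root → D.arm x = none → F x p = v p := fun x hx h => by
    have := F_dir x hx; rw [h] at this; exact this
  have F_some : ∀ x j, x ≠ D.root → D.arm x = some j → F x j = t j := fun x j hx h => by
    have := F_dir x hx; rw [h] at this; exact this.trans (base_self j)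
  have F_base : ∀ x j i, F x j = base i j → F x j = base (D.arm x) j := fun x j i h => by
    rcases F_cases x j with h1 | h1
    · exact h1.2
    · exact absurd (h1.2.symm.trans h) (σ_ne_base _ _ _)
  -- Vertices in distinct arms share an entry only where both have that of their base point.
  have F_distinct : ∀ x y j, D.arm x ≠ D.arm y → F x j = F y j →
      F x j = base (D.arm x) j ∧ F y j = base (D.arm y) j := by
    intro x y j hxy h
    rcases F_cases x j with h1 | h1
    · exact ⟨h1.2, F_base y j _ (h.symm.trans h1.2)⟩
    · rcases F_cases y j with h2 | h2
      · exact ⟨F_base x j _ (h.trans h2.2), h2.2⟩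
      · rw [h1.2, h2.2] at h
        exact absurd (congrArg Prod.fst (hσ j h)) hxy
  have F_eq_base : ∀ x, x ≠ D.root → (F x = base (D.arm x) ↔ x = D.attach (D.arm x)) := by
    intro x hx
    constructor
    · intro h
      refine (he x _ hx (D.attach_ne _) (D.arm_attach _).symm).2.1 (funext fun j => ?_)
      rcases F_cases x j with h1 | h1
      · exact h1.1
      · exact absurd (h1.2.symm.trans (congrFun h j)) (σ_ne_base _ _ _)
    · intro h
      funext j
      exact if_pos (by rw [← h])
  have F_ne_w : ∀ x, x ≠ D.root → F x ≠ w := by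
    intro x hx h
    rcases hx' : D.arm x with _ | j
    · exact hvw ((F_none x hx hx').symm.trans (congrFun h p))
    · exact htw j ((F_some x j hx hx').symm.trans (congrFun h j))
  have F_eq_v : ∀ x, x ≠ D.root → F x = v → D.arm x = none := by
    intro x hx h
    rcases hx' : D.arm x with _ | j
    · rfl
    · exact absurd ((F_some x j hx hx').symm.trans (congrFun h j)) (htv j)
  have z_p : z p = t p := Function.update_self _ _ _
  have F_eq_z : ∀ x, x ≠ D.root → F x = z → D.arm x = some p := by
    intro x hx h
    rcases hx' : D.arm x with _ | j
    · exact absurd ((F_none x hx hx').symm.trans ((congrFun h p).trans z_p)) (htv p).symm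
    · by_cases hj : j = p
      · rw [hj]
      · refine absurd ((F_some x j hx hx').symm.trans ((congrFun h j).trans ?_)) (htw j)
        exact Function.update_of_ne hj _ _
  have w_ne_v : w ≠ v := fun h => hvw (congrFun h p).symm
  have w_ne_z : w ≠ z := fun h => htw p ((congrFun h p).trans z_p).symm
  have adj_w : ∀ x, x ≠ D.root → (G'.Adj w (F x) ↔ x = D.attach (D.arm x)) := by
    intro x hx
    rw [← F_eq_base x hx]
    by_cases hxv : F x = v
    · rw [F_eq_v x hx hxv, hxv]
      exact iff_of_true hwv rfl
    rw [hG' w (F x) (by rw [Ne, Sym2.eq_iff]; tauto) (by rw [Ne, Sym2.eq_iff]; tauto)]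
    rcases hx' : D.arm x with _ | j
    · refine iff_of_false ?_ hxv
      rintro ⟨q, _, hu⟩
      obtain rfl : p = q := hu p fun h => hvw (h.trans (F_none x hx hx')).symm
      refine hxv (funext fun j => ?_)
      by_cases hj : j = p
      · rw [hj, F_none x hx hx']
      · have h1 : w j = F x j := by by_contra h; exact hj (hu j h)
        have h2 := F_base x j (some p) (h1.symm.trans (base_ne p j hj).symm)
        rw [hx'] at h2
        exact h2
    · constructor
      · rintro ⟨q, _, hu⟩
        obtain rfl : j = q := hu j fun h => htw j (h.trans (F_some x j hx hx')).symm
        funext l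
        by_cases hl : l = j
        · rw [hl, F_some x j hx hx', base_self]
        · rw [base_ne j l hl]
          by_contra h
          exact hl (hu l (Ne.symm h))
      · intro h
        rw [h]
        refine ⟨j, ?_, fun l hl => ?_⟩
        · change w j ≠ base (some j) j
          rw [base_self]; exact (htw j).symm
        · by_contra h'
          exact hl (base_ne j l h').symm
  have ordinary : ∀ x y, x ≠ D.root → y ≠ D.root →
      ¬ (F x = z ∧ F y = v) → ¬ (F x = v ∧ F y = z) →
      (G'.Adj (F x) (F y) ↔ (hammingGraph n k).Adj (F x) (F y)) := by
    intro x y hx hy h1 h2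
    have hwx := F_ne_w x hx
    have hwy := F_ne_w y hy
    refine hG' _ _ ?_ ?_ <;> rw [Ne, Sym2.eq_iff] <;> tauto
  have two_ne : ∀ {x y : Fin n → Fin k} {i j}, x i ≠ y i → x j ≠ y j → i ≠ j →
      ¬ (hammingGraph n k).Adj x y := fun hi hj hij h => hij (h.unique hi hj)
  -- Arm `none` against an arm `some j`; for `j = p` only the two base points need care.
  have none_some : ∀ x y j, x ≠ D.root → y ≠ D.root → D.arm x = none → D.arm y = some j →
      F x ≠ F y ∧ ¬ G'.Adj (F x) (F y) := by
    intro x y j hx hy hx' hy'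
    have hne : D.arm x ≠ D.arm y := by rw [hx', hy']; simp
    have hj : F x j ≠ F y j := fun h => by
      have h1 := (F_distinct x y j hne h).1
      rw [h, F_some y j hy hy', hx'] at h1
      exact htv j h1
    refine ⟨fun h => hj (congrFun h j), ?_⟩
    by_cases hjp : j = p
    · subst hjp
      by_cases hvz : F x = v ∧ F y = z
      · rw [hvz.1, hvz.2]
        exact fun h => hzv h.symm
      rw [ordinary x y hx hy (fun h => by simpa [hx'] using F_eq_z x hx h.1) hvz]
      intro hadj
      have hall : ∀ l, l ≠ j → F x l = F y l := fun l hl => by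
        by_contra h
        exact hl (hadj.unique h hj)
      refine hvz ⟨funext fun l => ?_, funext fun l => ?_⟩
      · by_cases hl : l = j
        · rw [hl, F_none x hx hx']
        · have := (F_distinct x y l hne (hall l hl)).1
          rw [hx'] at this
          exact this
      · by_cases hl : l = j
        · rw [hl, F_some y j hy hy', z_p]
        · have := (F_distinct x y l hne (hall l hl)).2
          rw [hy'] at this
          exact this
    · rw [ordinary x y hx hy (fun h => by simpa [hx'] using F_eq_z x hx h.1)
        (fun h => by simpa [hy', hjp] using F_eq_z y hy h.2)]
      refine two_ne hj (fun h => ?_ : F x p ≠ F y p) hjp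
      have h1 := (F_distinct x y p hne h).2
      rw [← h, F_none x hx hx', hy', base_ne j p (Ne.symm hjp)] at h1
      exact hvw h1
  have distinct : ∀ x y, x ≠ D.root → y ≠ D.root → D.arm x ≠ D.arm y →
      F x ≠ F y ∧ ¬ G'.Adj (F x) (F y) := by
    intro x y hx hy hne
    rcases hx' : D.arm x with _ | i <;> rcases hy' : D.arm y with _ | j
    · exact absurd (hx'.trans hy'.symm) hne
    · exact none_some x y j hx hy hx' hy'
    · have := none_some y x i hy hx hy' hx'
      exact ⟨this.1.symm, fun h => this.2 h.symm⟩
    · have hij : i ≠ j := fun h => hne (by rw [hx', hy', h])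
      have hi : F x i ≠ F y i := fun h => by
        have h1 := (F_distinct x y i hne h).2
        rw [← h, F_some x i hx hx', hy', base_ne j i hij] at h1
        exact htw i h1
      have hj : F x j ≠ F y j := fun h => by
        have h1 := (F_distinct x y j hne h).1
        rw [h, F_some y j hy hy', hx', base_ne i j hij.symm] at h1
        exact htw j h1
      rw [ordinary x y hx hy (fun h => by simpa [hy'] using F_eq_v y hy h.2)
        (fun h => by simpa [hx'] using F_eq_v x hx h.1)]
      exact ⟨fun h => hi (congrFun h i), two_ne hi hj hij⟩
  have same : ∀ x y, x ≠ D.root → y ≠ D.root → D.arm x = D.arm y →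
      (F x = F y → x = y) ∧ (G'.Adj (F x) (F y) ↔ H.Adj x y) := by
    intro x y hx hy hxy
    obtain ⟨h1, h2, -⟩ := he x y hx hy hxy
    refine ⟨fun h => h2 (funext fun j => (F_eq_iff x y hxy j).1 (congrFun h j)), ?_⟩
    rw [ordinary x y hx hy
      (fun h => by simpa [← hxy, F_eq_z x hx h.1] using F_eq_v y hy h.2)
      (fun h => by simpa [← hxy, F_eq_v x hx h.1] using F_eq_z y hy h.2), h1]
    simp only [hammingGraph, ne_eq, F_eq_iff x y hxy]
  let f : V → Fin n → Fin k := fun x => if x = D.root then w else F x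
  have f_root : f D.root = w := if_pos rfl
  have f_ne : ∀ x, x ≠ D.root → f x = F x := fun x hx => if_neg hx
  refine ⟨⟨⟨f, fun x y hxy => ?_⟩, fun {x y} => ?_⟩⟩
  · by_cases hx : x = D.root <;> by_cases hy : y = D.root
    · rw [hx, hy]
    · rw [hx, f_root, f_ne y hy] at hxy
      exact absurd hxy.symm (F_ne_w y hy)
    · rw [hy, f_root, f_ne x hx] at hxy
      exact absurd hxy (F_ne_w x hx)
    · rw [f_ne x hx, f_ne y hy] at hxy
      by_cases h : D.arm x = D.arm y
      · exact (same x y hx hy h).1 hxy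
      · exact absurd hxy (distinct x y hx hy h).1
  · change G'.Adj (f x) (f y) ↔ H.Adj x y
    by_cases hx : x = D.root <;> by_cases hy : y = D.root
    · rw [hx, hy]
      exact iff_of_false (G'.irrefl) (H.irrefl)
    · rw [hx, f_root, f_ne y hy, adj_w y hy, D.adj_root y hy]
    · rw [hy, f_root, f_ne x hx, G'.adj_comm, H.adj_comm, adj_w x hx, D.adj_root x hx]
    · rw [f_ne x hx, f_ne y hy]
      by_cases h : D.arm x = D.arm y
      · exact (same x y hx hy h).2
      · exact iff_of_false (distinct x y hx hy h).2 fun h' => h (D.arm_eq x y hx hy h')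

/-! ### Deleting and adding an edge -/

lemma exists_third_symbol {k : ℕ} (hk : 3 ≤ k) (a b : Fin k) : ∃ c, c ≠ a ∧ c ≠ b := by
  classical
  have h : ({a, b} : Finset (Fin k)).card < Fintype.card (Fin k) := by
    have : ({a, b} : Finset (Fin k)).card ≤ 2 := Finset.card_le_two
    rw [Fintype.card_fin]; omega
  obtain ⟨c, -, hc⟩ := Finset.exists_mem_notMem_of_card_lt_card (t := Finset.univ) h
  exact ⟨c, by simpa using hc⟩

theorem isIndContained_deleteEdges (D : ArmDecomposition H n m) {k : ℕ}
    (hk : (n + 1) * m + 3 ≤ k) {u v : Fin n → Fin k} (huv : (hammingGraph n k).Adj u v) :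
    H.IsIndContained ((hammingGraph n k).deleteEdges {s(u, v)}) := by
  obtain ⟨p, hp, hu⟩ := huv
  have huv' : ∀ j, j ≠ p → u j = v j := fun j hj => by by_contra h; exact hj (hu j h)
  obtain ⟨a, hau, hav⟩ := exists_third_symbol (by omega) (u p) (v p)
  choose t htu htv using fun j => exists_third_symbol (by omega) (u j) (v j)
  have hz : Function.update (Function.update u p a) p (Function.update t p (u p) p) = u := by simp
  refine D.isIndContained_of_adj_iff hk p (Function.update u p a) v (Function.update t p (u p))
    ?_ ?_ ?_ ?_ ?_ ?_
  · simpa using hav.symm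
  · intro j
    by_cases hj : j = p
    · subst hj; simpa using hau.symm
    · simpa [hj] using htu j
  · intro j
    by_cases hj : j = p
    · subst hj; simpa using hp
    · simpa [hj] using htv j
  · rw [deleteEdges_adj]
    refine ⟨⟨p, by simpa using hav, fun j hj => ?_⟩, ?_⟩
    · by_contra h
      exact hj (by simpa [h] using huv' j h)
    · rw [Set.mem_singleton_iff, Sym2.eq_iff]
      rintro (⟨h, -⟩ | ⟨h, -⟩)
      · exact hau (by simpa using congrFun h p)
      · exact hav (by simpa using congrFun h p)
  · rw [hz, deleteEdges_adj]
    exact fun h => h.2 rfl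
  · intro x y _ h
    rw [hz] at h
    rw [deleteEdges_adj, Set.mem_singleton_iff]
    exact and_iff_left h

theorem isIndContained_sup_edge (D : ArmDecomposition H n m) {k : ℕ}
    (hk : (n + 1) * m + 3 ≤ k) {u v : Fin n → Fin k} (huv : (hammingGraph n k)ᶜ.Adj u v) :
    H.IsIndContained (hammingGraph n k ⊔ edge u v) := by
  obtain ⟨hne, hnadj⟩ := (compl_adj _ _ _).1 huv
  obtain ⟨p, hp⟩ := Function.ne_iff.1 hne
  obtain ⟨q, hq, hqp⟩ : ∃ q, u q ≠ v q ∧ q ≠ p := by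
    by_contra! h
    exact hnadj ⟨p, hp, h⟩
  choose t htu htv using fun j => exists_third_symbol (by omega) (u j) (v j)
  refine D.isIndContained_of_adj_iff hk p u v t hp.symm htu htv ?_ ?_ ?_
  · simp [sup_adj, edge_adj, hne]
  · rw [sup_adj, edge_adj]
    rintro (h | ⟨⟨h, -⟩ | ⟨-, h⟩, -⟩)
    · -- The changed vertex still differs from `v` in both coordinates `p` and `q`.
      exact hqp (h.unique (by simpa [hqp] using hq) (by simpa using htv p))
    · exact htu p (by simpa using congrFun h p)
    · exact hne h.symm
  · intro x y h _
    rw [Ne, Sym2.eq_iff] at h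
    rw [sup_adj, edge_adj]
    tauto

end ArmDecomposition

end InducedSaturation

theorem theoremA {V : Type*} (n : ℕ) (hn : 3 ≤ n) (H : SimpleGraph V)
    (hH : InducedSaturation.ClassH n H) :
    ∃ k : ℕ, 2 ≤ k ∧
      InducedSaturation.InducedSaturated (InducedSaturation.hammingGraph n k) H := by
  obtain ⟨m, ⟨D⟩⟩ := hH.exists_armDecomposition (by omega)
  exact ⟨(n + 1) * m + 3, by omega, D.not_isIndContained _,
    fun _ _ => D.isIndContained_deleteEdges le_rfl, fun _ _ => D.isIndContained_sup_edge le_rfl⟩
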